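/- Let $A$ be a unital C*-algebra, $P\subset A$ a C*-subalgebra containing the unit of $A$, and $E\colon A\to P$ a conditional expectation of finite (Watatani) index: there is a quasi-basis for $E$, i.e. there are $u_1,\dots,u_n,v_1,\dots,v_n\in A$ with $a=\sum_i u_iE(v_ia)=\sum_i E(au_i)v_i$ for all $a\in A$. Put $\operatorname{Index}E=\sum_i u_iv_i$, which is an invertible element of $A$ independent of the choice of the quasi-basis. Let $e\in A$ be a projection ($e=e^*=e^2$) with $E(e)=(\operatorname{Index}E)^{-1}$, and let $Q=P\cap\{e\}'=\{x\in P: xe=ex\}$, a C*-subalgebra of $P$ containing the unit. (1) Then $ePe=Qe$, i.e. $\{exe:x\in P\}=\{qe:q\in Q\}$. (2) If moreover $e$ is full, i.e. $\sum_{i=1}^m x_iey_i=1$ for some $m$ and some $x_i,y_i\in A$, then $Q$ is a tunnel construction for $A\supset P$ with Jones projection $e$: there are a conditional expectation $F\colon P\to Q$ of finite index and a $*$-isomorphism $\pi\colon A\to C^*\langle P,e_Q\rangle$ with $\pi(x)=\lambda(x)$ for all $x\in P$ and $\pi(e)=e_Q$. Here $C^*\langle P,e_Q\rangle$ is the C*-basic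 construction of $F$: with $\mathcal E$ the completion of $P$ for the norm $\|F(x^*x)\|^{1/2}$, a right Hilbert $Q$-module with inner product extending $\langle x,y\rangle=F(x^*y)$, and $\eta\colon P\to\mathcal E$ the canonical map, $\lambda(x)\eta(y)=\eta(xy)$ and $e_Q\eta(y)=\eta(F(y))$ define adjointable $Q$-module operators on $\mathcal E$, and $C^*\langle P,e_Q\rangle$ is the norm closure of the linear span of $\{\lambda(x)e_Q\lambda(y):x,y\in P\}$. -/

import Mathlib

noncomputable section

set_option linter.unusedSectionVars false

namespace CStarInclusion

variable {A : Type*} [CStarAlgebra A] {P : StarSubalgebra ℂ A}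

/-- A conditional expectation of a unital C*-algebra `A` onto a unital C*-subalgebra `P`:
a positive `P`-bimodule map `A → P` that restricts to the identity on `P`.
Positivity is written out: `E (a* a)` is of the form `b* b` with `b ∈ P`. -/
structure CondExp (P : StarSubalgebra ℂ A) extends A →ₗ[ℂ] P where
  map_coe' : ∀ p : P, toFun (p : A) = p
  map_coe_mul' : ∀ (p : P) (a : A), toFun ((p : A) * a) = p * toFun a
  map_mul_coe' : ∀ (a : A) (p : P), toFun (a * (p : A)) = toFun a * p
  exists_eq_star_mul_self' : ∀ a : A, ∃ b : P, toFun (star a * a) = star b * b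

namespace CondExp

instance : FunLike (CondExp P) A P where
  coe E := E.toFun
  coe_injective := by
    rintro ⟨⟨⟨f, _⟩, _⟩, _⟩ ⟨⟨⟨g, _⟩, _⟩, _⟩ h
    congr

instance : LinearMapClass (CondExp P) ℂ A P where
  map_add E := E.map_add'
  map_smulₛₗ E := E.map_smul'

variable (E : CondExp P)

lemma map_coe (p : P) : E (p : A) = p := E.map_coe' p
lemma map_coe_mul (p : P) (a : A) : E ((p : A) * a) = p * E a := E.map_coe_mul' p a
lemma map_mul_coe (a : A) (p : P) : E (a * (p : A)) = E a * p := E.map_mul_coe' a p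

/-! ### Quasi-bases and the Watatani index -/

/-- `(u₁, v₁), …, (uₙ, vₙ)` is a quasi-basis for `E`. -/
def IsQuasiBasis {n : ℕ} (u v : Fin n → A) : Prop :=
  ∀ a : A, a = ∑ i, u i * (E (v i * a) : A) ∧ a = ∑ i, (E (a * u i) : A) * v i

/-- `Index E < ∞`: there is a quasi-basis for `E`. -/
def HasFiniteIndex : Prop :=
  ∃ (n : ℕ) (u v : Fin n → A), E.IsQuasiBasis u v

open Classical in
/-- The Watatani index `∑ uᵢ vᵢ`, for any quasi-basis `(uᵢ, vᵢ)` of `E`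
(meaningful only if there is one). -/
def index : A :=
  if h : E.HasFiniteIndex then
    ∑ i, h.choose_spec.choose i * h.choose_spec.choose_spec.choose i
  else 0

/-- The index does not depend on the quasi-basis. -/
lemma index_eq {n : ℕ} {u v : Fin n → A} (h : E.IsQuasiBasis u v) :
    E.index = ∑ i, u i * v i := by
  have key : ∀ {m k : ℕ} {s t : Fin m → A} {u v : Fin k → A}, E.IsQuasiBasis s t →
      E.IsQuasiBasis u v → ∑ i, s i * t i = ∑ i, u i * v i := by
    intro m k s t u v hs hu
    calc ∑ j, s j * t j = ∑ j, (∑ i, u i * (E (v i * s j) : A)) * t j :=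
          Finset.sum_congr rfl fun j _ => by rw [← (hu (s j)).1]
      _ = ∑ i, u i * ∑ j, (E (v i * s j) : A) * t j := by
          simp only [Finset.sum_mul, Finset.mul_sum, mul_assoc]
          exact Finset.sum_comm
      _ = ∑ i, u i * v i := Finset.sum_congr rfl fun i _ => by rw [← (hs (v i)).2]
  have hf : E.HasFiniteIndex := ⟨n, u, v, h⟩
  rw [index, dif_pos hf]
  exact key hf.choose_spec.choose_spec.choose_spec h

/-! ### Positivity and the Cauchy-Schwarz inequality -/

section order

attribute [local instance] CStarAlgebra.spectralOrder CStarAlgebra.spectralOrderedRing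

lemma coe_nonneg {a : A} (ha : 0 ≤ a) : 0 ≤ (E a : A) := by
  obtain ⟨b, rfl⟩ := CStarAlgebra.nonneg_iff_eq_star_mul_self.mp ha
  obtain ⟨c, hc⟩ := E.exists_eq_star_mul_self' b
  have : (E (star b * b) : A) = star (c : A) * c := by
    rw [show E (star b * b) = star c * c from hc]; simp
  rw [this]
  exact star_mul_self_nonneg _

lemma coe_mono {a b : A} (h : a ≤ b) : (E a : A) ≤ E b := by
  have := E.coe_nonneg (sub_nonneg.mpr h)
  rw [map_sub] at this
  simpa using this

lemma norm_le_norm {a b : A} (ha : 0 ≤ a) (h : a ≤ b) : ‖E a‖ ≤ ‖E b‖ :=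
  CStarAlgebra.norm_le_norm_of_nonneg_of_le (E.coe_nonneg ha) (E.coe_mono h)

lemma map_star (a : A) : E (star a) = star (E a) := by
  have sa : ∀ b : A, star (E (star b * b)) = E (star b * b) := by
    intro b
    obtain ⟨c, hc⟩ := E.exists_eq_star_mul_self' b
    rw [show E (star b * b) = star c * c from hc]; simp
  have pol : ∀ z : ℂ, star z * z = 1 →
      star (z • E (star a) + star z • E a) = z • E (star a) + star z • E a := by
    intro z hz
    have e1 : z • star a + star z • a = star (star a + star z • (1 : A)) * (star a + star z • (1 : A))
        - star (star a) * star a - star (1 : A) * 1 := by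
      simp only [star_add, star_star, star_smul, star_one, add_mul, mul_add, smul_mul_assoc,
        mul_smul_comm, one_mul, mul_one, smul_add, smul_smul, hz, one_smul]
      abel
    have e2 : z • E (star a) + star z • E a
        = E (star (star a + star z • (1 : A)) * (star a + star z • (1 : A)))
          - E (star (star a) * star a) - E (star (1 : A) * 1) := by
      rw [← map_sub, ← map_sub, ← e1, map_add, map_smul, map_smul]
    rw [e2, star_sub, star_sub, sa, sa, sa]
  have h1 := pol 1 (by simp)
  have hI := pol Complex.I (by simp)
  simp only [one_smul, star_one, star_add] at h1
  simp only [star_add, star_smul, star_neg, RCLike.star_def, Complex.conj_I, neg_smul, neg_neg] at hI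
  have hI' : star (E a) - star (E (star a)) = E (star a) - E a := by
    have : Complex.I • (star (E a) - star (E (star a))) = Complex.I • (E (star a) - E a) := by
      rw [smul_sub, smul_sub]
      rw [sub_eq_add_neg, sub_eq_add_neg, ← hI]
      abel
    exact smul_right_injective _ Complex.I_ne_zero this
  have h2 : (2 : ℂ) • E (star a) = (2 : ℂ) • star (E a) := by
    rw [two_smul, two_smul]
    calc E (star a) + E (star a) = (E (star a) + E a) + (E (star a) - E a) := by abel
      _ = (star (E (star a)) + star (E a)) + (star (E a) - star (E (star a))) := by rw [h1, hI']
      _ = _ := by abel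
  exact smul_right_injective _ two_ne_zero h2

lemma map_star_mul_self_coe (p : P) (x : A) :
    E (star (x * (p : A)) * (x * (p : A))) = star p * E (star x * x) * p := by
  rw [← E.map_coe_mul, ← E.map_mul_coe]
  congr 1
  simp [mul_assoc]

lemma norm_sq_map_star_mul_le (x y : A) :
    ‖E (star x * y)‖ ^ 2 ≤ ‖E (star x * x)‖ * ‖E (star y * y)‖ := by
  set p : P := E (star x * y) with hp
  set M : ℝ := ‖E (star x * x)‖ with hM
  set N : ℝ := ‖E (star y * y)‖ with hN
  have hq : E (star y * x) = star p := by rw [hp, ← E.map_star]; simp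
  have hsq : ‖star (p : A) * (p : A)‖ = ‖p‖ ^ 2 := by
    rw [CStarRing.norm_star_mul_self, sq]; rfl
  have key : ∀ t : ℝ, 0 ≤ t →
      (2 * t - t ^ 2 * M) • (star (p : A) * (p : A)) ≤ (E (star y * y) : A) := by
    intro t ht
    have h0 : 0 ≤ (E (star ((t : ℂ) • (x * (p : A)) - y) * ((t : ℂ) • (x * (p : A)) - y)) : A) :=
      E.coe_nonneg (star_mul_self_nonneg _)
    have h1 : E (star ((t : ℂ) • (x * (p : A)) - y) * ((t : ℂ) • (x * (p : A)) - y))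
        = ((t : ℂ) * t) • (star p * E (star x * x) * p) - (t : ℂ) • (star p * p)
          - (t : ℂ) • (star p * p) + E (star y * y) := by
      have a1 := E.map_star_mul_self_coe p x
      have a2 : E (star (x * (p : A)) * y) = star p * p := by
        conv_rhs => rw [hp, ← E.map_coe_mul]
        simp [mul_assoc, hp]
      have a3 : E (star y * (x * (p : A))) = star p * p := by
        rw [← mul_assoc, E.map_mul_coe, hq]
      simp only [star_sub, star_smul, sub_mul, mul_sub, smul_mul_assoc, mul_smul_comm, map_sub,
        map_smul, a1, a2, a3, RCLike.star_def, Complex.conj_ofReal, smul_sub, mul_smul]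
      abel
    rw [h1] at h0
    have h2 : star (p : A) * (E (star x * x) : A) * (p : A) ≤ M • (star (p : A) * (p : A)) :=
      CStarAlgebra.star_left_conjugate_le_norm_smul
        (E.coe_nonneg (star_mul_self_nonneg x)).isSelfAdjoint
    have h3 := smul_le_smul_of_nonneg_left h2 (sq_nonneg t)
    have h4 : (0 : A) ≤ t ^ 2 • (star (p : A) * (E (star x * x) : A) * (p : A))
        - (2 * t) • (star (p : A) * (p : A)) + (E (star y * y) : A) := by
      convert h0 using 1
      push_cast
      rw [← Complex.ofReal_mul, ← sq, Complex.coe_smul, Complex.coe_smul, two_mul, add_smul,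
        StarMemClass.coe_star]
      abel
    rw [sub_smul, sub_le_iff_le_add]
    rw [mul_smul (t ^ 2) M]
    have h5 := add_le_add h4 h3
    rw [← sub_nonneg] at h5 ⊢
    convert h5 using 1
    abel
  have main : ∀ ε : ℝ, 0 < ε → ‖p‖ ^ 2 ≤ (M + ε) * N := by
    intro ε hε
    have hM0 : 0 ≤ M := norm_nonneg _
    have hpos : 0 < M + ε := by positivity
    set t : ℝ := (M + ε)⁻¹ with ht
    have htpos : 0 < t := by positivity
    have h1 : t ≤ 2 * t - t ^ 2 * M := by
      have : t * (M + ε) = 1 := inv_mul_cancel₀ hpos.ne'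
      nlinarith [mul_pos htpos (mul_pos htpos hε)]
    have h2 : t • (star (p : A) * (p : A)) ≤ (E (star y * y) : A) :=
      (smul_le_smul_of_nonneg_right h1 (star_mul_self_nonneg _)).trans (key t htpos.le)
    have h3 := CStarAlgebra.norm_le_norm_of_nonneg_of_le
      (smul_nonneg htpos.le (star_mul_self_nonneg (p : A))) h2
    rw [norm_smul, hsq, Real.norm_of_nonneg htpos.le] at h3
    calc ‖p‖ ^ 2 = (M + ε) * (t * ‖p‖ ^ 2) := by
          rw [← mul_assoc, ht, mul_inv_cancel₀ hpos.ne', one_mul]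
      _ ≤ (M + ε) * N := by gcongr; exact h3
  refine le_of_forall_pos_le_add fun δ hδ => ?_
  have hN0 : 0 ≤ N := norm_nonneg _
  refine (main (δ / (N + 1)) (by positivity)).trans ?_
  rw [add_mul]
  gcongr
  rw [div_mul_eq_mul_div, div_le_iff₀ (by positivity)]
  nlinarith

lemma norm_map_star_mul_mul_le (a x : A) :
    ‖E (star (a * x) * (a * x))‖ ≤ ‖a‖ ^ 2 * ‖E (star x * x)‖ := by
  have h : star (a * x) * (a * x) ≤ ((‖a‖ ^ 2 : ℝ) : ℂ) • (star x * x) := by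
    rw [star_mul, mul_assoc, ← mul_assoc (star a), ← mul_assoc, sq, ← CStarRing.norm_star_mul_self,
      Complex.coe_smul]
    exact CStarAlgebra.star_left_conjugate_le_norm_smul
  have := E.norm_le_norm (star_mul_self_nonneg _) h
  rwa [map_smul, norm_smul, Complex.norm_real, Real.norm_of_nonneg (by positivity)] at this

lemma norm_map_star_mul_right_le (p : P) (x : A) :
    ‖E (star (x * (p : A)) * (x * (p : A)))‖ ≤ ‖p‖ ^ 2 * ‖E (star x * x)‖ := by
  rw [E.map_star_mul_self_coe]
  refine (norm_mul_le _ _).trans ?_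
  refine (mul_le_mul_of_nonneg_right (norm_mul_le _ _) (norm_nonneg _)).trans ?_
  rw [norm_star]
  apply le_of_eq
  ring

lemma norm_map_star_mul_jones_le (x : A) :
    ‖E (star (E x : A) * (E x : A))‖ ≤ ‖E (star x * x)‖ := by
  have h0 : 0 ≤ (E (star (x - (E x : A)) * (x - (E x : A))) : A) :=
    E.coe_nonneg (star_mul_self_nonneg _)
  have h1 : E (star (E x : A) * (E x : A)) = star (E x) * E x := by
    rw [E.map_mul_coe, E.map_star, E.map_coe]
  have h2 : E (star (x - (E x : A)) * (x - (E x : A))) = E (star x * x) - star (E x) * E x := by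
    rw [star_sub, sub_mul, mul_sub, mul_sub, map_sub, map_sub, map_sub, h1, E.map_mul_coe, E.map_star]
    have : E (star (E x : A) * x) = star (E x) * E x := by
      rw [← E.map_coe_mul]; simp
    rw [this]
    abel
  rw [h2] at h0
  rw [h1]
  refine CStarAlgebra.norm_le_norm_of_nonneg_of_le (A := A) (a := (star (E x) * E x : P)) ?_ ?_
  · simp
  · simpa using h0

end order

/-! ### The Hilbert module -/

set_option linter.unusedVariables false in
/-- The space `A` with the `P`-valued (semi-)inner product `⟨x, y⟩ = E (x* y)`. -/
@[nolint unusedArguments]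
def PreModule (E : CondExp P) : Type _ := A

instance : AddCommGroup E.PreModule := inferInstanceAs (AddCommGroup A)
instance : Module ℂ E.PreModule := inferInstanceAs (Module ℂ A)

/-- The identity map from `A` to `PreModule`. -/
def toPre : A ≃ₗ[ℂ] E.PreModule := LinearEquiv.refl ℂ A

/-- The identity map from `PreModule` to `A`. -/
def ofPre : E.PreModule ≃ₗ[ℂ] A := E.toPre.symm

@[simp] lemma toPre_ofPre (x : E.PreModule) : E.toPre (E.ofPre x) = x := rfl
@[simp] lemma ofPre_toPre (a : A) : E.ofPre (E.toPre a) = a := rfl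

/-- The inner product `⟨x, y⟩ = E (x* y)`. -/
def preInner (x y : E.PreModule) : P := E (star (E.ofPre x) * E.ofPre y)

/-- The norm `‖x‖ = ‖⟨x, x⟩‖ ^ (1/2)`. -/
instance : Norm E.PreModule := ⟨fun x => √‖E.preInner x x‖⟩

lemma pre_norm_sq (x : E.PreModule) : ‖x‖ ^ 2 = ‖E.preInner x x‖ :=
  Real.sq_sqrt (norm_nonneg _)

lemma norm_preInner_le (x y : E.PreModule) : ‖E.preInner x y‖ ≤ ‖x‖ * ‖y‖ := by
  have h := E.norm_sq_map_star_mul_le (E.ofPre x) (E.ofPre y)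
  refine abs_le_of_sq_le_sq' ?_ (mul_nonneg (Real.sqrt_nonneg _) (Real.sqrt_nonneg _)) |>.2
  rw [mul_pow, Real.sq_sqrt (norm_nonneg _), Real.sq_sqrt (norm_nonneg _)]
  exact h

lemma pre_core : SeminormedSpace.Core ℂ E.PreModule where
  norm_nonneg _ := Real.sqrt_nonneg _
  norm_smul c x := by
    have : E.preInner (c • x) (c • x) = (star c * c) • E.preInner x x := by
      simp only [preInner, map_smul, star_smul, smul_mul_assoc, mul_smul_comm, smul_smul]
      rw [mul_comm]
    change √‖E.preInner (c • x) (c • x)‖ = ‖c‖ * √‖E.preInner x x‖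
    rw [this, norm_smul, CStarRing.norm_star_mul_self, Real.sqrt_mul (by positivity),
      Real.sqrt_mul_self (norm_nonneg _)]
  norm_triangle x y := by
    have h0 : ∀ z : E.PreModule, 0 ≤ ‖z‖ := fun z => Real.sqrt_nonneg _
    refine abs_le_of_sq_le_sq' ?_ (add_nonneg (h0 x) (h0 y)) |>.2
    have : E.preInner (x + y) (x + y) = E.preInner x x + E.preInner x y
        + (E.preInner y x + E.preInner y y) := by
      simp only [preInner, map_add, star_add, add_mul, mul_add]
      abel
    rw [pre_norm_sq, this]
    calc _ ≤ ‖E.preInner x x‖ + ‖E.preInner x y‖ + (‖E.preInner y x‖ + ‖E.preInner y y‖) :=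
          (norm_add_le _ _).trans (add_le_add (norm_add_le _ _) (norm_add_le _ _))
      _ ≤ ‖x‖ ^ 2 + ‖x‖ * ‖y‖ + (‖y‖ * ‖x‖ + ‖y‖ ^ 2) := by
          rw [pre_norm_sq, pre_norm_sq]
          gcongr <;> exact E.norm_preInner_le _ _
      _ = _ := by ring

instance : SeminormedAddCommGroup E.PreModule := SeminormedAddCommGroup.ofCore E.pre_core
instance : NormedSpace ℂ E.PreModule where
  norm_smul_le c x := (E.pre_core.norm_smul c x).le

/-- The completion of `A` for the norm `‖E (x* x)‖ ^ (1/2)`. -/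
abbrev HilbertModule := UniformSpace.Completion E.PreModule

/-- The canonical map `A → HilbertModule`; it is injective if `E` is faithful. -/
def eta : A →ₗ[ℂ] E.HilbertModule :=
  (UniformSpace.Completion.toComplL (𝕜 := ℂ) (E := E.PreModule)).toLinearMap ∘ₗ E.toPre.toLinearMap

lemma eta_apply (a : A) : E.eta a = (E.toPre a : E.HilbertModule) := rfl

lemma denseRange_eta : DenseRange E.eta :=
  UniformSpace.Completion.denseRange_coe (α := E.PreModule)

/-- The inner product of `PreModule` as a bounded sesquilinear map. -/
def preInnerSL : E.PreModule →L⋆[ℂ] E.PreModule →L[ℂ] P :=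
  LinearMap.mkContinuous₂
    (LinearMap.mk₂'ₛₗ (starRingEnd ℂ) (RingHom.id ℂ) E.preInner
      (by intro x y z; simp [preInner, add_mul])
      (by intro c x y; simp [preInner])
      (by intro x y z; simp [preInner, mul_add])
      (by intro c x y; simp [preInner]))
    1 (fun x y => by rw [one_mul]; exact E.norm_preInner_le x y)

lemma induction_eta {p : E.HilbertModule → Prop} (hc : IsClosed {ξ | p ξ})
    (h : ∀ x : A, p (E.eta x)) (ξ : E.HilbertModule) : p ξ :=
  UniformSpace.Completion.induction_on ξ hc h

lemma induction_eta₂ {p : E.HilbertModule → E.HilbertModule → Prop}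
    (hc : IsClosed {q : E.HilbertModule × E.HilbertModule | p q.1 q.2})
    (h : ∀ x y : A, p (E.eta x) (E.eta y)) (ξ ζ : E.HilbertModule) : p ξ ζ :=
  UniformSpace.Completion.induction_on₂ ξ ζ hc h

/-- A linear map on `A` that is bounded for the norm `‖E (x* x)‖ ^ (1/2)`, extended to the
completion. -/
def extendMap (f : A →ₗ[ℂ] A) (C : ℝ) (hC : 0 ≤ C)
    (hf : ∀ x, ‖E (star (f x) * f x)‖ ≤ C ^ 2 * ‖E (star x * x)‖) :
    E.HilbertModule →L[ℂ] E.HilbertModule :=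
  ((E.toPre.toLinearMap ∘ₗ f ∘ₗ E.ofPre.toLinearMap).mkContinuous C (fun x => by
    refine abs_le_of_sq_le_sq' ?_ (mul_nonneg hC (norm_nonneg _)) |>.2
    rw [mul_pow, pre_norm_sq, pre_norm_sq]
    exact hf (E.ofPre x))).completion

lemma extendMap_eta (f : A →ₗ[ℂ] A) (C : ℝ) (hC : 0 ≤ C)
    (hf : ∀ x, ‖E (star (f x) * f x)‖ ≤ C ^ 2 * ‖E (star x * x)‖) (x : A) :
    E.extendMap f C hC hf (E.eta x) = E.eta (f x) := by
  rw [eta_apply, extendMap, ContinuousLinearMap.completion_apply_coe]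
  rfl

variable [hP : IsClosed (P : Set A)]

/-- The continuous extension of the inner product `⟨x, y⟩ = E (x* y)` to the completion. -/
def innerSL : E.HilbertModule →L⋆[ℂ] E.HilbertModule →L[ℂ] P :=
  ((E.preInnerSL.extend
    (UniformSpace.Completion.toComplL (𝕜 := ℂ) (E := E.PreModule))).flip.extend
      (UniformSpace.Completion.toComplL (𝕜 := ℂ) (E := E.PreModule))).flip

/-- The `P`-valued inner product of the Hilbert module. -/
def inner (ξ ζ : E.HilbertModule) : P := E.innerSL ξ ζ

lemma continuous_inner : Continuous fun p : E.HilbertModule × E.HilbertModule =>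
    E.inner p.1 p.2 :=
  (E.innerSL.continuous.comp continuous_fst).clm_apply continuous_snd

lemma inner_eta (x y : A) : E.inner (E.eta x) (E.eta y) = E (star x * y) := by
  have hd : DenseRange (UniformSpace.Completion.toComplL (𝕜 := ℂ) (E := E.PreModule)) :=
    UniformSpace.Completion.denseRange_coe (α := E.PreModule)
  have hu : IsUniformInducing (UniformSpace.Completion.toComplL (𝕜 := ℂ) (E := E.PreModule)) :=
    UniformSpace.Completion.isUniformInducing_coe _
  rw [inner, innerSL, ContinuousLinearMap.flip_apply]
  erw [ContinuousLinearMap.extend_eq _ hd hu, ContinuousLinearMap.flip_apply,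
    ContinuousLinearMap.extend_eq _ hd hu]
  rfl

lemma star_inner (ξ ζ : E.HilbertModule) : star (E.inner ξ ζ) = E.inner ζ ξ := by
  refine E.induction_eta₂ (p := fun ξ ζ => star (E.inner ξ ζ) = E.inner ζ ξ) ?_ ?_ ξ ζ
  · exact isClosed_eq (continuous_star.comp E.continuous_inner)
      (E.continuous_inner.comp continuous_swap)
  · intro x y
    rw [inner_eta, inner_eta, ← E.map_star]
    simp

lemma norm_sq_eq (ξ : E.HilbertModule) : ‖ξ‖ ^ 2 = ‖E.inner ξ ξ‖ := by
  refine E.induction_eta (p := fun ξ => ‖ξ‖ ^ 2 = ‖E.inner ξ ξ‖) ?_ ?_ ξ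
  · exact isClosed_eq (continuous_norm.pow 2)
      (continuous_norm.comp (E.continuous_inner.comp (continuous_id.prodMk continuous_id)))
  · intro x
    rw [inner_eta, eta_apply, UniformSpace.Completion.norm_coe]
    exact E.pre_norm_sq (E.toPre x)

lemma norm_inner_le (ξ ζ : E.HilbertModule) : ‖E.inner ξ ζ‖ ≤ ‖ξ‖ * ‖ζ‖ := by
  refine E.induction_eta₂ (p := fun ξ ζ => ‖E.inner ξ ζ‖ ≤ ‖ξ‖ * ‖ζ‖) ?_ ?_ ξ ζ
  · exact isClosed_le (continuous_norm.comp E.continuous_inner)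
      ((continuous_norm.comp continuous_fst).mul (continuous_norm.comp continuous_snd))
  · intro x y
    rw [inner_eta, eta_apply, eta_apply, UniformSpace.Completion.norm_coe,
      UniformSpace.Completion.norm_coe]
    exact E.norm_preInner_le (E.toPre x) (E.toPre y)

lemma inner_sub_right (ξ ζ ζ' : E.HilbertModule) :
    E.inner ξ (ζ - ζ') = E.inner ξ ζ - E.inner ξ ζ' := map_sub (E.innerSL ξ) ζ ζ'

lemma ext_inner {ζ ζ' : E.HilbertModule} (h : ∀ ξ, E.inner ξ ζ = E.inner ξ ζ') : ζ = ζ' := by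
  have h0 : ‖ζ - ζ'‖ ^ 2 = 0 := by
    rw [norm_sq_eq, inner_sub_right, h, sub_self, norm_zero]
  exact sub_eq_zero.mp (norm_eq_zero.mp (pow_eq_zero_iff two_ne_zero |>.mp h0))

/-- The right action of `p ∈ P` on the Hilbert module: `η(x) p = η(x p)`. -/
def rightMul (p : P) : E.HilbertModule →L[ℂ] E.HilbertModule :=
  E.extendMap (LinearMap.mulRight ℂ (p : A)) ‖p‖ (norm_nonneg p)
    (fun x => E.norm_map_star_mul_right_le p x)

lemma rightMul_eta (p : P) (x : A) : E.rightMul p (E.eta x) = E.eta (x * (p : A)) :=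
  E.extendMap_eta _ _ _ _ x

/-- Left multiplication on the Hilbert module: `η(x) ↦ η(a x)`. -/
def leftMul (a : A) : E.HilbertModule →L[ℂ] E.HilbertModule :=
  E.extendMap (LinearMap.mulLeft ℂ a) ‖a‖ (norm_nonneg a)
    (fun x => E.norm_map_star_mul_mul_le a x)

lemma leftMul_eta (a x : A) : E.leftMul a (E.eta x) = E.eta (a * x) :=
  E.extendMap_eta _ _ _ _ x

/-- The operator `η(x) ↦ η(E x)` on the Hilbert module. -/
def projMap : E.HilbertModule →L[ℂ] E.HilbertModule :=
  E.extendMap (P.subtype.toLinearMap ∘ₗ E.toLinearMap) 1 zero_le_one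
    (fun x => by rw [one_pow, one_mul]; exact E.norm_map_star_mul_jones_le x)

lemma projMap_eta (x : A) : E.projMap (E.eta x) = E.eta (E x : A) :=
  E.extendMap_eta _ _ _ _ x

/-! ### Adjointable operators -/

/-- `S` is an adjoint of `T`. -/
def IsAdjoint (T S : E.HilbertModule →L[ℂ] E.HilbertModule) : Prop :=
  ∀ ξ ζ, E.inner (T ξ) ζ = E.inner ξ (S ζ)

/-- `T` is a homomorphism of right `P`-modules. -/
def IsModuleMap (T : E.HilbertModule →L[ℂ] E.HilbertModule) : Prop :=
  ∀ (p : P) (ξ : E.HilbertModule), T (E.rightMul p ξ) = E.rightMul p (T ξ)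

variable {E} in
lemma IsAdjoint.symm {T S : E.HilbertModule →L[ℂ] E.HilbertModule} (h : E.IsAdjoint T S) :
    E.IsAdjoint S T := fun ξ ζ => by
  rw [← E.star_inner, ← h, E.star_inner]

variable {E} in
lemma IsAdjoint.unique {T S S' : E.HilbertModule →L[ℂ] E.HilbertModule} (h : E.IsAdjoint T S)
    (h' : E.IsAdjoint T S') : S = S' := by
  ext ζ
  exact E.ext_inner fun ξ => by rw [← h, ← h']

/-- The algebra `L_P` of the (bounded) right `P`-module maps on the Hilbert module that have an
adjoint right `P`-module map, with the operator norm. -/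
def adjointable : Subalgebra ℂ (E.HilbertModule →L[ℂ] E.HilbertModule) where
  carrier := {T | E.IsModuleMap T ∧ ∃ S, E.IsModuleMap S ∧ E.IsAdjoint T S}
  mul_mem' := by
    rintro T T' ⟨hT, S, hS, h⟩ ⟨hT', S', hS', h'⟩
    refine ⟨fun p ξ => ?_, S' * S, fun p ξ => ?_, fun ξ ζ => ?_⟩
    · simp only [mul_apply_eq_comp, hT' p, hT p]
    · simp only [mul_apply_eq_comp, hS' p, hS p]
    · simp only [mul_apply_eq_comp, h _ _, h' _ _]
  add_mem' := by
    rintro T T' ⟨hT, S, hS, h⟩ ⟨hT', S', hS', h'⟩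
    refine ⟨fun p ξ => ?_, S + S', fun p ξ => ?_, fun ξ ζ => ?_⟩
    · simp only [add_apply, hT' p, hT p, map_add]
    · simp only [add_apply, hS' p, hS p, map_add]
    · have h1 := h ξ ζ
      have h2 := h' ξ ζ
      simp only [inner, add_apply, map_add] at h1 h2 ⊢
      rw [h1, h2]
  algebraMap_mem' c := by
    refine ⟨fun p ξ => ?_, algebraMap ℂ _ (star c), fun p ξ => ?_, fun ξ ζ => ?_⟩
    · simp [Algebra.algebraMap_eq_smul_one]
    · simp [Algebra.algebraMap_eq_smul_one]
    · simp [Algebra.algebraMap_eq_smul_one, inner]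

/-- `L_P` as a type; its elements are viewed as operators by `op`. -/
def Adjointable : Type _ := E.adjointable

instance : NormedRing E.Adjointable := inferInstanceAs (NormedRing E.adjointable)
instance : NormedAlgebra ℂ E.Adjointable := inferInstanceAs (NormedAlgebra ℂ E.adjointable)

/-- The inclusion of `L_P` in the bounded operators. -/
def op : E.Adjointable →ₐ[ℂ] (E.HilbertModule →L[ℂ] E.HilbertModule) := E.adjointable.val

lemma op_injective : Function.Injective E.op := Subtype.val_injective

lemma norm_op (T : E.Adjointable) : ‖E.op T‖ = ‖T‖ := rfl

lemma exists_adjoint (T : E.Adjointable) : ∃ S : E.Adjointable, E.IsAdjoint (E.op T) (E.op S) := by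
  obtain ⟨T, hT, S, hS, h⟩ := T
  exact ⟨⟨S, hS, T, hT, h.symm⟩, h⟩

/-- The involution of `L_P` is the adjoint. -/
instance : Star E.Adjointable := ⟨fun T => (E.exists_adjoint T).choose⟩

lemma isAdjoint_star (T : E.Adjointable) : E.IsAdjoint (E.op T) (E.op (star T)) :=
  (E.exists_adjoint T).choose_spec

lemma star_eq {T S : E.Adjointable} (h : E.IsAdjoint (E.op T) (E.op S)) : star T = S :=
  E.op_injective ((E.isAdjoint_star T).unique h)

instance : StarRing E.Adjointable where
  star_involutive T := E.star_eq (E.isAdjoint_star T).symm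
  star_mul T T' := E.star_eq fun ξ ζ => by
    rw [map_mul, map_mul]
    simp only [mul_apply_eq_comp, E.isAdjoint_star T _ _, E.isAdjoint_star T' _ _]
  star_add T T' := E.star_eq fun ξ ζ => by
    have h1 := E.isAdjoint_star T ξ ζ
    have h2 := E.isAdjoint_star T' ξ ζ
    simp only [inner, map_add, add_apply] at h1 h2 ⊢
    rw [h1, h2]

instance : StarModule ℂ E.Adjointable where
  star_smul c T := E.star_eq fun ξ ζ => by
    have h1 := E.isAdjoint_star T ξ ζ
    simp only [inner] at h1
    rw [map_smul, map_smul]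
    simp [inner, h1]

instance : CStarRing E.Adjointable where
  norm_mul_self_le T := by
    have key : ‖E.op T‖ ≤ √‖star T * T‖ := by
      refine ContinuousLinearMap.opNorm_le_bound _ (Real.sqrt_nonneg _) fun ξ => ?_
      refine abs_le_of_sq_le_sq' ?_ (mul_nonneg (Real.sqrt_nonneg _) (norm_nonneg _)) |>.2
      rw [norm_sq_eq, E.isAdjoint_star T, mul_pow, Real.sq_sqrt (norm_nonneg _)]
      refine (E.norm_inner_le _ _).trans ?_
      have h1 : ‖E.op (star T) (E.op T ξ)‖ ≤ ‖star T * T‖ * ‖ξ‖ := by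
        rw [← norm_op, map_mul]
        exact (E.op (star T) * E.op T).le_opNorm ξ
      nlinarith [norm_nonneg ξ]
    rw [← norm_op] at *
    calc ‖E.op T‖ * ‖E.op T‖ ≤ √‖E.op (star T * T)‖ * √‖E.op (star T * T)‖ := by gcongr
      _ = ‖E.op (star T * T)‖ := Real.mul_self_sqrt (norm_nonneg _)

instance : CompleteSpace E.Adjointable := by
  refine Metric.complete_of_cauchySeq_tendsto fun u hu => ?_
  have hiso : Isometry E.op := AddMonoidHomClass.isometry_of_norm E.op E.norm_op
  have hstar : Isometry (star : E.Adjointable → E.Adjointable) := star_isometry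
  have hcT : CauchySeq fun n => E.op (u n) := hiso.uniformContinuous.comp_cauchySeq hu
  have hcS : CauchySeq fun n => E.op (star (u n)) :=
    (hiso.comp hstar).uniformContinuous.comp_cauchySeq hu
  obtain ⟨T, hT⟩ := cauchySeq_tendsto_of_complete hcT
  obtain ⟨S, hS⟩ := cauchySeq_tendsto_of_complete hcS
  have hap : ∀ {v : ℕ → (E.HilbertModule →L[ℂ] E.HilbertModule)}
      {V : E.HilbertModule →L[ℂ] E.HilbertModule} (_ : Filter.Tendsto v Filter.atTop (nhds V))
      (ξ : E.HilbertModule), Filter.Tendsto (fun n => v n ξ) Filter.atTop (nhds (V ξ)) :=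
    fun hv ξ => ((ContinuousLinearMap.apply ℂ E.HilbertModule ξ).continuous.tendsto _).comp hv
  have hmod : ∀ {v : ℕ → E.Adjointable} {V : E.HilbertModule →L[ℂ] E.HilbertModule},
      Filter.Tendsto (fun n => E.op (v n)) Filter.atTop (nhds V) → E.IsModuleMap V := by
    intro v V hv p ξ
    refine tendsto_nhds_unique (hap hv _) ?_
    have : (fun n => E.op (v n) (E.rightMul p ξ)) = fun n => E.rightMul p (E.op (v n) ξ) :=
      funext fun n => (v n).2.1 p ξ
    rw [this]
    exact ((E.rightMul p).continuous.tendsto _).comp (hap hv ξ)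
  have hadj : E.IsAdjoint T S := fun ξ ζ => by
    have h1 := (E.continuous_inner.tendsto (T ξ, ζ)).comp
      ((hap hT ξ).prodMk_nhds (tendsto_const_nhds (x := ζ)))
    have h2 := (E.continuous_inner.tendsto (ξ, S ζ)).comp
      ((tendsto_const_nhds (x := ξ)).prodMk_nhds (hap hS ζ))
    refine tendsto_nhds_unique h1 (h2.congr fun n => ?_)
    exact (E.isAdjoint_star (u n) ξ ζ).symm
  refine ⟨⟨T, hmod hT, S, hmod (v := fun n => star (u n)) hS, hadj⟩, ?_⟩
  exact hiso.isEmbedding.tendsto_nhds_iff.mpr hT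

instance : CStarAlgebra E.Adjointable where

/-! ### The basic construction -/

lemma isModuleMap_of_eta {T : E.HilbertModule →L[ℂ] E.HilbertModule}
    (h : ∀ (p : P) (x : A), T (E.rightMul p (E.eta x)) = E.rightMul p (T (E.eta x))) :
    E.IsModuleMap T := fun p ξ => by
  refine E.induction_eta (p := fun ξ => T (E.rightMul p ξ) = E.rightMul p (T ξ)) ?_ (h p) ξ
  exact isClosed_eq (by fun_prop) (by fun_prop)

lemma isAdjoint_of_eta {T S : E.HilbertModule →L[ℂ] E.HilbertModule}
    (h : ∀ x y : A, E.inner (T (E.eta x)) (E.eta y) = E.inner (E.eta x) (S (E.eta y))) :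
    E.IsAdjoint T S := fun ξ ζ => by
  refine E.induction_eta₂ (p := fun ξ ζ => E.inner (T ξ) ζ = E.inner ξ (S ζ)) ?_ h ξ ζ
  exact isClosed_eq
    (E.continuous_inner.comp ((T.continuous.comp continuous_fst).prodMk continuous_snd))
    (E.continuous_inner.comp (continuous_fst.prodMk (S.continuous.comp continuous_snd)))

lemma ext_eta {T S : E.HilbertModule →L[ℂ] E.HilbertModule}
    (h : ∀ x : A, T (E.eta x) = S (E.eta x)) : T = S := by
  ext ξ
  exact E.induction_eta (p := fun ξ => T ξ = S ξ)
    (isClosed_eq T.continuous S.continuous) h ξ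

lemma isModuleMap_leftMul (a : A) : E.IsModuleMap (E.leftMul a) :=
  E.isModuleMap_of_eta fun p x => by simp only [rightMul_eta, leftMul_eta, mul_assoc]

lemma isAdjoint_leftMul (a : A) : E.IsAdjoint (E.leftMul a) (E.leftMul (star a)) :=
  E.isAdjoint_of_eta fun x y => by simp only [leftMul_eta, inner_eta, star_mul, mul_assoc]

lemma isModuleMap_projMap : E.IsModuleMap E.projMap :=
  E.isModuleMap_of_eta fun p x => by
    simp only [rightMul_eta, projMap_eta, E.map_mul_coe]
    rfl

lemma isAdjoint_projMap : E.IsAdjoint E.projMap E.projMap :=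
  E.isAdjoint_of_eta fun x y => by
    rw [projMap_eta, projMap_eta, inner_eta, inner_eta, E.map_mul_coe, E.map_star,
      ← StarMemClass.coe_star, E.map_coe_mul]

/-- The representation `λ` of `A` in `L_P` with `λ(a) η(x) = η(a x)`. -/
def lam : A →⋆ₐ[ℂ] E.Adjointable where
  toFun a := ⟨E.leftMul a, E.isModuleMap_leftMul a, E.leftMul (star a),
    E.isModuleMap_leftMul (star a), E.isAdjoint_leftMul a⟩
  map_one' := Subtype.ext <| E.ext_eta fun x => by
    change E.leftMul 1 (E.eta x) = E.eta x
    rw [leftMul_eta, one_mul]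
  map_mul' a b := Subtype.ext <| E.ext_eta fun x => by
    change E.leftMul (a * b) (E.eta x) = E.leftMul a (E.leftMul b (E.eta x))
    rw [leftMul_eta, leftMul_eta, leftMul_eta, mul_assoc]
  map_zero' := Subtype.ext <| E.ext_eta fun x => by
    change E.leftMul 0 (E.eta x) = 0
    rw [leftMul_eta, zero_mul, map_zero]
  map_add' a b := Subtype.ext <| E.ext_eta fun x => by
    change E.leftMul (a + b) (E.eta x) = E.leftMul a (E.eta x) + E.leftMul b (E.eta x)
    rw [leftMul_eta, leftMul_eta, leftMul_eta, add_mul, map_add]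
  commutes' c := Subtype.ext <| E.ext_eta fun x => by
    change E.leftMul (algebraMap ℂ A c) (E.eta x)
      = algebraMap ℂ (E.HilbertModule →L[ℂ] E.HilbertModule) c (E.eta x)
    rw [leftMul_eta, Algebra.algebraMap_eq_smul_one, Algebra.algebraMap_eq_smul_one,
      smul_one_mul, map_smul]
    rfl
  map_star' a := (E.star_eq (E.isAdjoint_leftMul a)).symm

lemma lam_apply_eta (a x : A) : E.op (E.lam a) (E.eta x) = E.eta (a * x) := E.leftMul_eta a x

/-- The Jones projection `e_P ∈ L_P` with `e_P η(x) = η(E x)`. -/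
def jonesProj : E.Adjointable :=
  ⟨E.projMap, E.isModuleMap_projMap, E.projMap, E.isModuleMap_projMap, E.isAdjoint_projMap⟩

lemma jonesProj_apply_eta (x : A) : E.op E.jonesProj (E.eta x) = E.eta (E x : A) := E.projMap_eta x

lemma star_jonesProj : star E.jonesProj = E.jonesProj := E.star_eq E.isAdjoint_projMap

lemma jonesProj_mul_lam_mul_jonesProj (a : A) :
    E.jonesProj * E.lam a * E.jonesProj = E.lam (E a : A) * E.jonesProj :=
  Subtype.ext <| E.ext_eta fun x => by
    change E.op E.jonesProj (E.op (E.lam a) (E.op E.jonesProj (E.eta x)))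
      = E.op (E.lam (E a : A)) (E.op E.jonesProj (E.eta x))
    rw [jonesProj_apply_eta, lam_apply_eta, jonesProj_apply_eta, lam_apply_eta, E.map_mul_coe]
    rfl

/-- The linear span of the operators `λ(x) e_P λ(y)`, `x, y ∈ A`. -/
def spanConstruction : NonUnitalStarSubalgebra ℂ E.Adjointable :=
  { Submodule.span ℂ (Set.range fun q : A × A => E.lam q.1 * E.jonesProj * E.lam q.2) with
    mul_mem' := by
      intro S T hS hT
      refine Submodule.span_induction₂ (p := fun S T _ _ => S * T ∈
        Submodule.span ℂ (Set.range fun q : A × A => E.lam q.1 * E.jonesProj * E.lam q.2))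
        ?_ ?_ ?_ ?_ ?_ ?_ ?_ hS hT
      · rintro _ _ ⟨⟨x, y⟩, rfl⟩ ⟨⟨x', y'⟩, rfl⟩
        refine Submodule.subset_span ⟨(x * (E (y * x') : A), y'), ?_⟩
        have := E.jonesProj_mul_lam_mul_jonesProj (y * x')
        simp only [map_mul] at this ⊢
        calc _ = E.lam x * (E.lam (E (y * x') : A) * E.jonesProj) * E.lam y' := by
              simp only [mul_assoc]
          _ = _ := by rw [← this]; simp only [mul_assoc]
      · intro T _; simp
      · intro T _; simp
      · intro S S' T _ _ _ h h'; rw [add_mul]; exact add_mem h h'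
      · intro S T T' _ _ _ h h'; rw [mul_add]; exact add_mem h h'
      · intro c S T _ _ h; rw [smul_mul_assoc]; exact Submodule.smul_mem _ c h
      · intro c S T _ _ h; rw [mul_smul_comm]; exact Submodule.smul_mem _ c h
    star_mem' := by
      intro T hT
      refine Submodule.span_induction (p := fun T _ => star T ∈
        Submodule.span ℂ (Set.range fun q : A × A => E.lam q.1 * E.jonesProj * E.lam q.2))
        ?_ ?_ ?_ ?_ hT
      · rintro _ ⟨⟨x, y⟩, rfl⟩
        refine Submodule.subset_span ⟨(star y, star x), ?_⟩
        simp only [star_mul, StarHomClass.map_star, star_jonesProj, mul_assoc]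
      · simp
      · intro S T _ _ h h'; rw [star_add]; exact add_mem h h'
      · intro c T _ h; rw [star_smul]; exact Submodule.smul_mem _ _ h }

/-- The C*-basic construction of a faithful conditional expectation (in particular, of one of
finite index): the norm closure in `L_P` of the linear span of the operators
`λ(x) e_P λ(y)`, `x, y ∈ A`. -/
def basicConstruction : NonUnitalStarSubalgebra ℂ E.Adjointable :=
  E.spanConstruction.topologicalClosure

lemma coe_basicConstruction : (E.basicConstruction : Set E.Adjointable) = closure
    (Submodule.span ℂ (Set.range fun q : A × A => E.lam q.1 * E.jonesProj * E.lam q.2)) := rfl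

end CondExp

/-! ### Tunnel constructions -/

/-- The relative commutant `P ∩ {e}'` of a projection `e`, as a C*-subalgebra of `P`
(the centralizer in Mathlib's sense is `{e, e*}'`, which is `{e}'` as `e = e*`). -/
def relCommutant (P : StarSubalgebra ℂ A) (e : A) : StarSubalgebra ℂ P :=
  (StarSubalgebra.centralizer ℂ {e}).comap P.subtype

lemma mem_relCommutant {e : A} (he : IsSelfAdjoint e) {x : P} :
    x ∈ relCommutant P e ↔ (x : A) * e = e * x := by
  simp [relCommutant, StarSubalgebra.mem_centralizer_iff, he.star_eq, eq_comm]

instance (e : A) : IsClosed (relCommutant P e : Set P) := by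
  have : (relCommutant P e : Set P)
      = (fun x : P => (x : A)) ⁻¹' (({e} ∪ star {e} : Set A).centralizer) := by
    ext x; rfl
  rw [this]
  exact (Set.isClosed_centralizer _).preimage continuous_subtype_val

/-- `e` is full: there are `xᵢ, yᵢ ∈ A` with `∑ xᵢ e yᵢ = 1`. -/
def IsFull (e : A) : Prop :=
  ∃ (n : ℕ) (x y : Fin n → A), ∑ i, x i * e * y i = 1

/-- The C*-subalgebra `Q` of `P` is a tunnel construction for `A ⊃ P` such that `e ∈ A` is the
Jones projection for `P ⊃ Q`: there is a conditional expectation `F : P → Q` of finite index such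
that `A` is the basic construction of `P ⊃ Q`, by a *-isomorphism that is `λ` on `P` and maps `e`
to the Jones projection of `F`. -/
def IsTunnelConstruction (P : StarSubalgebra ℂ A) [IsClosed (P : Set A)] (Q : StarSubalgebra ℂ P)
    [IsClosed (Q : Set P)] (e : A) : Prop :=
  ∃ F : CondExp Q, F.HasFiniteIndex ∧ ∃ π : A ≃⋆ₐ[ℂ] F.basicConstruction,
    (∀ x : P, (π (x : A) : F.Adjointable) = F.lam x) ∧ (π e : F.Adjointable) = F.jonesProj

end CStarInclusion

end

noncomputable section

set_option linter.unusedSectionVars false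

namespace CStarInclusion

variable {A : Type*} [CStarAlgebra A] {P : StarSubalgebra ℂ A}

namespace CondExp

variable {E : CondExp P}

/-! ### Quasi-bases -/

/-! Everything rests on the Jones relation Index E · e E(e x) = e x (`index_mul_mul_map`). The
defect y(x) = e x - Index E · e E(e x) is right P-linear, and for a quasi-basis (wᵢ, wᵢ*) one finds
∑ y(wᵢ) y(wᵢ)* = 0, so y vanishes on every wᵢ and hence everywhere. The normalisation of E(e) enters
as y(e) = 0.

The adjoint relation x e = Index E · E(x e) e shows that A e = P e, and p ↦ p e is injective on P
because E(p e) = p E(e) with E(e) invertible. Left multiplication of A on A e thus becomes an action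
`act` of A on P. The two relations together show that F = `act e` takes values commuting with e and
that F(x) e = e x e; this gives ePe = Qe, and F is a conditional expectation of P onto Q.

If e is full, A e = P e lets the coefficients be moved into P: ∑ pᵢ e qᵢ = 1. This identity makes
(pᵢ, qᵢ) a quasi-basis of F. The action extends to a representation of A on the Hilbert module of F
which is λ on P and sends e to e_Q. It is injective because P e P spans 1, and surjective because an
adjointable T equals ∑ T λ(pᵢ) e_Q λ(qᵢ), with each T λ(pᵢ) e_Q of the form λ(tᵢ) e_Q.

The background fact, used for both E and F, is that η is bijective for finite index, so that vectors
of the completion come from the algebra. It also yields the quasi-bases (wᵢ, wᵢ*) and the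
invertibility of the index. -/

lemma IsQuasiBasis.eq_zero_of_map_star_mul_self {n : ℕ} {u v : Fin n → A}
    (h : E.IsQuasiBasis u v) {x : A} (hx : E (star x * x) = 0) : x = 0 := by
  -- By Cauchy-Schwarz all coefficients of x in the quasi-basis vanish.
  have h0 : ∀ y : A, E (y * x) = 0 := fun y => by
    have := E.norm_sq_map_star_mul_le (star y) x
    rw [hx, norm_zero, mul_zero, star_star] at this
    exact norm_eq_zero.mp (pow_eq_zero_iff two_ne_zero |>.mp (le_antisymm this (sq_nonneg _)))
  rw [(h x).1]
  simp [h0]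

/-- Expanding a uⱼ by the left formula and vᵢ a by the right one turns both products into the double
sum ∑ uᵢ E(vᵢ a uⱼ) vⱼ. -/
lemma IsQuasiBasis.commute_index {n : ℕ} {u v : Fin n → A} (h : E.IsQuasiBasis u v) (a : A) :
    Commute E.index a := by
  rw [E.index_eq h]
  change (∑ i, u i * v i) * a = a * ∑ i, u i * v i
  symm
  calc a * ∑ j, u j * v j = ∑ j, (∑ i, u i * (E (v i * (a * u j)) : A)) * v j := by
        rw [Finset.mul_sum]
        exact Finset.sum_congr rfl fun j _ => by rw [← (h (a * u j)).1, mul_assoc]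
    _ = ∑ i, u i * ∑ j, (E (v i * a * u j) : A) * v j := by
        simp only [Finset.sum_mul, Finset.mul_sum, mul_assoc]
        exact Finset.sum_comm
    _ = (∑ i, u i * v i) * a := by
        rw [Finset.sum_mul]
        exact Finset.sum_congr rfl fun i _ => by rw [← (h (v i * a)).2, mul_assoc]

/-- A one-sided quasi-basis of the form `(wᵢ, wᵢ*)` is a quasi-basis. -/
lemma isQuasiBasis_star {n : ℕ} {w : Fin n → A}
    (h : ∀ a, a = ∑ i, w i * (E (star (w i) * a) : A)) : E.IsQuasiBasis w (fun i => star (w i)) := by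
  refine fun a => ⟨h a, ?_⟩
  have := congrArg star (h (star a))
  rw [star_star, star_sum] at this
  refine this.trans (Finset.sum_congr rfl fun i _ => ?_)
  rw [star_mul, ← StarMemClass.coe_star, ← E.map_star, star_mul, star_star, star_star]

/-! ### The Hilbert module in the case of finite index -/

variable [hP : IsClosed (P : Set A)]

lemma norm_eta_le (x : A) : ‖E.eta x‖ ≤ √‖E 1‖ * ‖x‖ := by
  refine abs_le_of_sq_le_sq' ?_ (by positivity) |>.2
  rw [norm_sq_eq, inner_eta, mul_pow, Real.sq_sqrt (norm_nonneg _), mul_comm]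
  simpa using E.norm_map_star_mul_mul_le x 1

lemma continuous_eta : Continuous E.eta :=
  (E.eta.mkContinuous _ E.norm_eta_le).continuous

lemma IsQuasiBasis.eta_injective {n : ℕ} {u v : Fin n → A} (h : E.IsQuasiBasis u v) :
    Function.Injective E.eta := by
  refine (injective_iff_map_eq_zero _).mpr fun x hx => h.eq_zero_of_map_star_mul_self ?_
  rw [← inner_eta, hx]
  exact map_zero (E.innerSL 0)

/-- For finite index the algebra is complete in the norm of the Hilbert module. -/
lemma IsQuasiBasis.eta_surjective {n : ℕ} {u v : Fin n → A} (h : E.IsQuasiBasis u v) :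
    Function.Surjective E.eta := by
  intro ξ
  -- The coefficient E(vᵢ x) is the inner product of η(vᵢ*) with η(x), so the quasi-basis expansion
  -- makes sense for every ξ and stays valid by continuity.
  refine ⟨∑ i, u i * (E.inner (E.eta (star (v i))) ξ : A), ?_⟩
  refine E.induction_eta
    (p := fun ξ => E.eta (∑ i, u i * (E.inner (E.eta (star (v i))) ξ : A)) = ξ) ?_ ?_ ξ
  · refine isClosed_eq (E.continuous_eta.comp (continuous_finsetSum _ fun i _ => ?_)) continuous_id
    exact continuous_const.mul (continuous_subtype_val.comp
      (E.continuous_inner.comp (continuous_const.prodMk continuous_id)))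
  · intro x
    simp only [inner_eta, star_star]
    rw [← (h x).1]

/-- The range of λ(a) e_P consists of the vectors η(a) p with p ∈ P, up to closure, so by
P-linearity only the value of T at η(a) matters. -/
lemma mul_lam_mul_jonesProj {T : E.Adjointable} {a t : A} (h : E.op T (E.eta a) = E.eta t) :
    T * E.lam a * E.jonesProj = E.lam t * E.jonesProj :=
  E.op_injective <| E.ext_eta fun x => by
    simp only [map_mul, mul_apply_eq_comp, jonesProj_apply_eta, lam_apply_eta]
    have hm : E.IsModuleMap (E.op T) := T.2.1
    rw [← rightMul_eta, ← rightMul_eta, hm, h]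

lemma jonesProj_mul_self : E.jonesProj * E.jonesProj = E.jonesProj := by
  have := E.jonesProj_mul_lam_mul_jonesProj 1
  have h1 : E 1 = 1 := by simpa using E.map_coe 1
  simpa [h1] using this

/-- The identity of the Hilbert module is in the span of the `λ(x) e_P λ(y)`. -/
lemma IsQuasiBasis.sum_lam_mul_jonesProj_mul_lam {n : ℕ} {u v : Fin n → A}
    (h : E.IsQuasiBasis u v) : ∑ i, E.lam (u i) * E.jonesProj * E.lam (v i) = 1 :=
  E.op_injective <| E.ext_eta fun x => by
    simp only [map_sum, map_mul, map_one, sum_apply, mul_apply_eq_comp, jonesProj_apply_eta,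
      lam_apply_eta]
    rw [← map_sum, ← (h x).1]
    rfl

/-! ### Self-adjoint quasi-bases and invertibility of the index -/

section order

attribute [local instance] CStarAlgebra.spectralOrder CStarAlgebra.spectralOrderedRing

/-- If `∑ aᵢ f bᵢ = 1` with a projection `f`, then `∑ sⱼ f sⱼ* = 1` for some `sⱼ`. -/
lemma exists_sum_mul_star_eq_one {B : Type*} [CStarAlgebra B] {f : B}
    (hf : IsStarProjection f) {n : ℕ} {a b : Fin n → B} (h : ∑ i, a i * f * b i = 1) :
    ∃ (m : ℕ) (s : Fin m → B), ∑ j, s j * f * star (s j) = 1 := by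
  set r : Fin (n + n) → B := Fin.append a (fun i => star (b i))
  set H : B := ∑ j, r j * f * star (r j) with hH
  have hH' : H = ∑ i, a i * f * star (a i) + ∑ i, star (b i) * f * b i := by
    simp only [hH, r, Fin.sum_univ_add, Fin.append_left, Fin.append_right, star_star]
  have hpos : ∀ x : B, 0 ≤ x * f * star x := fun x =>
    star_right_conjugate_nonneg hf.nonneg x
  have h' : ∑ i, star (b i) * f * star (a i) = 1 := by
    have := congrArg star h
    simpa [star_sum, mul_assoc, hf.isSelfAdjoint.star_eq] using this
  -- Expanding ∑ (aᵢ - bᵢ*) f (aᵢ - bᵢ*)* ≥ 0 gives H ≥ 2, as each of the two cross sums is 1.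
  have h2 : (1 : B) ≤ H := by
    have h3 : 0 ≤ ∑ i, (a i - star (b i)) * f * star (a i - star (b i)) :=
      Finset.sum_nonneg fun i _ => hpos _
    have h4 : ∑ i, (a i - star (b i)) * f * star (a i - star (b i)) = H - (1 + 1) := by
      nth_rewrite 1 [← h]
      rw [← h', hH']
      simp only [star_sub, star_star, sub_mul, mul_sub, Finset.sum_sub_distrib]
      abel
    rw [h4, sub_nonneg] at h3
    exact (le_add_of_nonneg_left zero_le_one).trans h3
  obtain ⟨U, hU⟩ := CStarAlgebra.isUnit_of_le (1 : B) h2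
  have hU0 : 0 ≤ (U : B) := hU ▸ zero_le_one.trans h2
  -- k = H^(-1/2); conjugating by it normalises the sum to 1.
  set k : B := CFC.sqrt (U⁻¹ : Bˣ) with hk
  have hkk : k * k = (U⁻¹ : Bˣ) := CFC.sqrt_mul_sqrt_self _ (CFC.inv_nonneg_of_nonneg U hU0)
  have hks : star k = k := (CFC.sqrt_nonneg _).isSelfAdjoint.star_eq
  have hkH : k * H * k = 1 := by
    have hc : Commute (U⁻¹ : Bˣ).val k := by
      rw [← hkk]; exact (Commute.refl k).mul_left (Commute.refl k)
    have hc' : Commute (U : B) k := by simpa using hc.units_inv_left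
    rw [← hU, ← hc'.eq, mul_assoc, hkk, Units.mul_inv]
  refine ⟨n + n, fun j => k * r j, ?_⟩
  rw [← hkH, hH, Finset.mul_sum, Finset.sum_mul]
  exact Finset.sum_congr rfl fun j _ => by simp only [star_mul, hks, mul_assoc]

end order

lemma isStarProjection_jonesProj : IsStarProjection E.jonesProj :=
  ⟨E.jonesProj_mul_self, E.star_jonesProj⟩

/-- For finite index there is a quasi-basis of the form `(wᵢ, wᵢ*)`. -/
lemma HasFiniteIndex.exists_isQuasiBasis_star (hE : E.HasFiniteIndex) :
    ∃ (n : ℕ) (w : Fin n → A), E.IsQuasiBasis w (fun i => star (w i)) := by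
  obtain ⟨n, u, v, h⟩ := hE
  obtain ⟨m, s, hs⟩ := exists_sum_mul_star_eq_one E.isStarProjection_jonesProj
    h.sum_lam_mul_jonesProj_mul_lam
  -- The vector sⱼ η(1) comes from some wⱼ ∈ A, and then sⱼ e_P = λ(wⱼ) e_P: the operators sⱼ may be
  -- replaced by elements of A.
  choose w hw using fun j => h.eta_surjective (E.op (s j) (E.eta 1))
  refine ⟨m, w, isQuasiBasis_star fun x => h.eta_injective ?_⟩
  have h1 : ∀ j, s j * E.jonesProj = E.lam (w j) * E.jonesProj := fun j => by
    simpa using E.mul_lam_mul_jonesProj (a := 1) (hw j).symm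
  have h2 : ∀ j, s j * E.jonesProj * star (s j)
      = E.lam (w j) * E.jonesProj * E.lam (star (w j)) := fun j => by
    calc _ = (s j * E.jonesProj) * star (s j * E.jonesProj) := by
          rw [star_mul, star_jonesProj, mul_assoc, mul_assoc, ← mul_assoc E.jonesProj E.jonesProj,
            jonesProj_mul_self]
      _ = _ := by
          rw [h1, star_mul, star_jonesProj, StarHomClass.map_star, mul_assoc, mul_assoc,
            ← mul_assoc E.jonesProj E.jonesProj, jonesProj_mul_self]
  simp only [h2] at hs
  have h3 := congrArg (fun T => E.op T (E.eta x)) hs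
  simp only [map_sum, map_mul, map_one, sum_apply, mul_apply_eq_comp, jonesProj_apply_eta,
    lam_apply_eta] at h3
  rw [map_sum, h3]
  rfl

/-- Since e_P ≤ 1, the identity 1 = ∑ λ(wᵢ) e_P λ(wᵢ)* gives 1 ≤ λ(Index E). The inverse in L_P,
evaluated at η(1), yields a right inverse in A, which is two-sided because the index is central. -/
lemma HasFiniteIndex.isUnit_index (hE : E.HasFiniteIndex) : IsUnit E.index := by
  let := CStarAlgebra.spectralOrder E.Adjointable
  let := CStarAlgebra.spectralOrderedRing E.Adjointable
  obtain ⟨n, w, hw⟩ := hE.exists_isQuasiBasis_star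
  have h1 : (1 : E.Adjointable) ≤ E.lam E.index := by
    rw [← hw.sum_lam_mul_jonesProj_mul_lam, E.index_eq hw, map_sum]
    refine Finset.sum_le_sum fun i _ => ?_
    rw [map_mul, StarHomClass.map_star]
    simpa using star_right_conjugate_le_conjugate E.isStarProjection_jonesProj.le_one
      (E.lam (w i))
  obtain ⟨U, hU⟩ := CStarAlgebra.isUnit_of_le (1 : E.Adjointable) h1
  obtain ⟨t, ht⟩ := hw.eta_surjective (E.op (U⁻¹ : E.Adjointableˣ) (E.eta 1))
  have h2 : E.index * t = 1 := hw.eta_injective <| by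
    rw [← lam_apply_eta, ht, ← hU]
    change (E.op U * E.op (U⁻¹ : E.Adjointableˣ)) (E.eta 1) = _
    rw [← map_mul, Units.mul_inv, map_one]
    rfl
  exact ⟨⟨E.index, t, h2, by rw [← (hw.commute_index t).eq, h2]⟩, rfl⟩

/-! ### Projections with `E e = (Index E)⁻¹` -/

/-- `e` is a projection with `Index E · E e = 1`, for `E` of finite index. -/
structure IsTunnelProjection (E : CondExp P) (e : A) : Prop where
  hasFiniteIndex : E.HasFiniteIndex
  isStarProjection : IsStarProjection e
  index_mul_map : E.index * (E e : A) = 1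

namespace IsTunnelProjection

variable {e : A} (he : E.IsTunnelProjection e)
include he

lemma commute_index (a : A) : Commute E.index a :=
  he.hasFiniteIndex.choose_spec.choose_spec.choose_spec.commute_index a

lemma map_mul_index : (E e : A) * E.index = 1 := by
  rw [← (he.commute_index _).eq, he.index_mul_map]

lemma mul_self : e * e = e := he.isStarProjection.isIdempotentElem.eq

lemma star_eq : star e = e := he.isStarProjection.isSelfAdjoint.star_eq

/-- The index lies in P: E(Index E) and Index E are both inverses of E(e). -/
lemma coe_map_index : (E E.index : A) = E.index := by
  have h1 : (E E.index : A) * (E e : A) = 1 := by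
    have h := E.map_mul_coe E.index (E e)
    rw [he.index_mul_map] at h
    have h1 : E 1 = 1 := by simpa using E.map_coe 1
    rw [h1] at h
    exact congrArg Subtype.val h.symm
  calc (E E.index : A) = E E.index * ((E e : A) * E.index) := by rw [he.map_mul_index, mul_one]
    _ = _ := by rw [← mul_assoc, h1, one_mul]

lemma commute_map (a : A) : Commute (E e : A) a := by
  calc (E e : A) * a = (E e : A) * a * (E.index * E e) := by rw [he.index_mul_map, mul_one]
    _ = (E e : A) * (E.index * a) * E e := by rw [(he.commute_index a).eq]; simp only [mul_assoc]
    _ = a * E e := by rw [← mul_assoc (E e : A), he.map_mul_index, one_mul]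

lemma star_index : star E.index = E.index := by
  obtain ⟨n, w, hw⟩ := he.hasFiniteIndex.exists_isQuasiBasis_star
  rw [E.index_eq hw, star_sum]
  simp

/-- The Jones relation `Index E · e e_P e = e`. -/
lemma index_mul_mul_map (x : A) : E.index * (e * (E (e * x) : A)) = e * x := by
  obtain ⟨n, w, hw⟩ := he.hasFiniteIndex.exists_isQuasiBasis_star
  set y : A →ₗ[ℂ] A :=
    { toFun := fun x => e * x - E.index * (e * (E (e * x) : A))
      map_add' := fun x z => by simp only [mul_add, map_add, AddMemClass.coe_add]; abel
      map_smul' := fun c x => by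
        simp only [mul_smul_comm, map_smul, SetLike.val_smul, smul_sub, RingHom.id_apply] }
  have y_apply : ∀ x, y x = e * x - E.index * (e * (E (e * x) : A)) := fun x => rfl
  have y_mul : ∀ (x : A) (p : P), y (x * p) = y x * p := fun x p => by
    simp only [y_apply, ← mul_assoc, E.map_mul_coe, MulMemClass.coe_mul, sub_mul]
  -- The normalisation Index E · E(e) = 1 is used here.
  have y_e : y e = 0 := by
    rw [y_apply, he.mul_self, ← (he.commute_map e).eq, ← mul_assoc, he.index_mul_map, one_mul,
      sub_self]
  -- ∑ E(e wᵢ) wᵢ* = e, so the sum is e · Index E - Index E · e.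
  have y_sum : ∑ i, y (w i) * star (w i) = 0 := by
    simp only [y_apply, sub_mul, Finset.sum_sub_distrib, mul_assoc]
    rw [← Finset.mul_sum, ← Finset.mul_sum, ← Finset.mul_sum, ← E.index_eq hw, ← (hw e).2,
      he.mul_self, (he.commute_index e).eq, sub_self]
  have star_y : ∀ x, star (y x) = star x * e - E.index * ((E (star x * e) : A) * e) := fun x => by
    rw [y_apply, star_sub, star_mul, star_mul, star_mul, he.star_eq, he.star_index,
      ← StarMemClass.coe_star, ← E.map_star, star_mul, he.star_eq, (he.commute_index _).eq]
  -- Expanding y(wᵢ)* leaves `y_sum` and ∑ y(wᵢ) E(wᵢ* e), which is y(e) by P-linearity.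
  have y_star_sum : ∑ i, y (w i) * star (y (w i)) = 0 := by
    have h1 : ∑ i, y (w i) * (E (star (w i) * e) : A) = 0 := by
      simp only [← y_mul]
      rw [← map_sum, ← (hw e).1, y_e]
    calc _ = (∑ i, y (w i) * star (w i)) * e
          - E.index * ((∑ i, y (w i) * (E (star (w i) * e) : A)) * e) := by
          rw [Finset.sum_mul, Finset.sum_mul, Finset.mul_sum, ← Finset.sum_sub_distrib]
          refine Finset.sum_congr rfl fun i _ => ?_
          rw [star_y, mul_sub, (he.commute_index (y (w i))).symm.left_comm]
          simp only [mul_assoc]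
      _ = 0 := by rw [y_sum, h1]; simp
  have y_w : ∀ i, y (w i) = 0 := by
    let := CStarAlgebra.spectralOrder A
    let := CStarAlgebra.spectralOrderedRing A
    intro i
    have := (Finset.sum_eq_zero_iff_of_nonneg fun i _ => mul_star_self_nonneg (y (w i))).mp
      y_star_sum i (Finset.mem_univ i)
    exact CStarRing.mul_star_self_eq_zero_iff _ |>.mp this
  have : y x = 0 := by
    rw [(hw x).1, map_sum]
    exact Finset.sum_eq_zero fun i _ => by rw [y_mul, y_w, zero_mul]
  exact (sub_eq_zero.mp this).symm

/-- The adjoint of the Jones relation. Since Index E · E(x e) lies in P, it says that A e = P e. -/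
lemma index_mul_map_mul (x : A) : E.index * ((E (x * e) : A) * e) = x * e := by
  have := congrArg star (he.index_mul_mul_map (star x))
  rwa [star_mul, star_mul, star_mul, he.star_eq, he.star_index, ← StarMemClass.coe_star,
    ← E.map_star, star_mul, he.star_eq, star_star, ← (he.commute_index _).eq] at this

/-- `x ↦ x e` is injective on `P`. -/
lemma eq_of_mul_eq {x y : P} (h : (x : A) * e = y * e) : x = y := by
  -- x is recovered from x e because E(x e) = x E(e).
  have h1 : ∀ x : P, (x : A) = E.index * (E ((x : A) * e) : A) := fun x => by
    rw [E.map_coe_mul, MulMemClass.coe_mul, ← (he.commute_map _).eq, ← mul_assoc,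
      he.index_mul_map, one_mul]
  exact Subtype.ext (by rw [h1 x, h, ← h1])

end IsTunnelProjection

/-! ### The action of A on P ≅ A e and the conditional expectation onto P ∩ {e}' -/

namespace IsTunnelProjection

variable {e : A} (he : E.IsTunnelProjection e)

/-- The operator on `P` that corresponds to left multiplication by `a` on `A e = P e`. -/
def act (_ : E.IsTunnelProjection e) (a : A) : P →ₗ[ℂ] P where
  -- `E E.index` is the index itself, viewed in P.
  toFun x := E E.index * E (a * x * e)
  map_add' x y := by simp [mul_add, add_mul]
  map_smul' c x := by simp

include he

lemma coe_act (a : A) (x : P) : (he.act a x : A) = E.index * (E (a * x * e) : A) := by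
  simp [act, he.coe_map_index]

/-- Characterises `act a x`, as p ↦ p e is injective on P; identities for `act` are checked after
multiplication by e on the right. -/
lemma act_mul (a : A) (x : P) : (he.act a x : A) * e = a * x * e := by
  rw [coe_act, mul_assoc, he.index_mul_map_mul]

/-- Both sides are e x e: the left by `act_mul`, the right by the Jones relation applied to x e. -/
lemma act_comm (x : P) : (he.act e x : A) * e = e * he.act e x := by
  rw [act_mul, coe_act, (he.commute_index e).symm.left_comm]
  have := he.index_mul_mul_map (x * e)
  simpa only [mul_assoc] using this.symm

lemma act_mem (x : P) : he.act e x ∈ relCommutant P e :=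
  (mem_relCommutant he.isStarProjection.isSelfAdjoint).mpr (he.act_comm x)

lemma coe_mem_comm (q : relCommutant P e) : ((q : P) : A) * e = e * (q : P) :=
  (mem_relCommutant he.isStarProjection.isSelfAdjoint).mp q.2

lemma act_mul_coe (a : A) (x : P) (q : relCommutant P e) :
    he.act a (x * (q : P)) = he.act a x * (q : P) :=
  he.eq_of_mul_eq <| by
    rw [act_mul, MulMemClass.coe_mul, MulMemClass.coe_mul, mul_assoc (he.act a x : A),
      he.coe_mem_comm, ← mul_assoc (he.act a x : A), he.act_mul]
    simp only [mul_assoc, he.coe_mem_comm]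

section order

attribute [local instance] CStarAlgebra.spectralOrder CStarAlgebra.spectralOrderedRing

/-- The square root stays in P, which is closed, and in the commutant of e, so positivity in A gives
positivity in P ∩ {e}'. -/
lemma exists_eq_star_mul_self {z : relCommutant P e} (hz : (0 : A) ≤ (z : P)) :
    ∃ b : relCommutant P e, z = star b * b := by
  set s : A := CFC.sqrt ((z : P) : A) with hs
  have hsP : s ∈ P := by
    rw [hs, CFC.sqrt_eq_real_sqrt _ hz]
    exact cfcₙ_mem (𝕜 := ℝ) (𝕜' := ℂ) _ (z : P).2
  have hse : Commute s e := Commute.cfcₙ_nnreal (he.coe_mem_comm z) _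
  refine ⟨⟨⟨s, hsP⟩, (mem_relCommutant he.isStarProjection.isSelfAdjoint).mpr hse⟩, ?_⟩
  refine Subtype.ext (Subtype.ext ?_)
  change ((z : P) : A) = star s * s
  rw [(CFC.sqrt_nonneg _ : 0 ≤ s).isSelfAdjoint.star_eq, hs, CFC.sqrt_mul_sqrt_self _ hz]

lemma index_nonneg : 0 ≤ E.index := by
  obtain ⟨n, w, hw⟩ := he.hasFiniteIndex.exists_isQuasiBasis_star
  rw [E.index_eq hw]
  exact Finset.sum_nonneg fun i _ => mul_star_self_nonneg _

lemma act_star_mul_self_nonneg (x : P) : 0 ≤ (he.act e (star x * x) : A) := by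
  rw [coe_act]
  refine (he.commute_index _).mul_nonneg he.index_nonneg (E.coe_nonneg ?_)
  have := star_mul_self_nonneg ((x : A) * e)
  rw [star_mul, he.star_eq] at this
  simpa [mul_assoc] using this

end order

/-- The conditional expectation `x ↦ Index E · E (e x e)` of `P` onto `P ∩ {e}'`. -/
def condExp : CondExp (relCommutant P e) where
  toFun x := ⟨he.act e x, he.act_mem x⟩
  map_add' x y := Subtype.ext (map_add _ x y)
  map_smul' c x := Subtype.ext (map_smul _ c x)
  map_coe' q := Subtype.ext <| he.eq_of_mul_eq <| by
    change (he.act e (q : P) : A) * e = _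
    rw [act_mul, ← he.coe_mem_comm, mul_assoc, he.mul_self]
  map_coe_mul' q x := Subtype.ext <| he.eq_of_mul_eq <| by
    change (he.act e ((q : P) * x) : A) * e = (((q : P) * he.act e x : P) : A) * e
    rw [act_mul, MulMemClass.coe_mul, MulMemClass.coe_mul, mul_assoc (q : P).1, act_mul,
      ← mul_assoc, ← he.coe_mem_comm]
    simp only [mul_assoc]
  map_mul_coe' x q := Subtype.ext (he.act_mul_coe e x q)
  exists_eq_star_mul_self' x := he.exists_eq_star_mul_self (he.act_star_mul_self_nonneg x)

lemma coe_condExp (x : P) : (he.condExp x : P) = he.act e x := rfl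

lemma condExp_mul (x : P) : ((he.condExp x : P) : A) * e = e * x * e := he.act_mul e x

/-- e x e = F(x) e in one direction; q e = e q e in the other. -/
lemma range_compression : Set.range (fun x : P => e * (x : A) * e)
    = Set.range (fun q : relCommutant P e => ((q : P) : A) * e) := by
  ext a
  constructor
  · rintro ⟨x, rfl⟩
    exact ⟨he.condExp x, he.condExp_mul x⟩
  · rintro ⟨q, rfl⟩
    refine ⟨q, ?_⟩
    simp only [← he.coe_mem_comm, mul_assoc, he.mul_self]

/-! ### Fullness and the quasi-basis of F -/

lemma exists_full (hf : IsFull e) :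
    ∃ (n : ℕ) (p q : Fin n → P), ∑ i, (p i : A) * e * q i = 1 := by
  obtain ⟨n, x, y, h⟩ := hf
  -- Chosen so that pᵢ e = xᵢ e and, by adjoints, e qᵢ = e yᵢ.
  refine ⟨n, fun i => he.act (x i) 1, fun i => star (he.act (star (y i)) 1), ?_⟩
  rw [← h]
  refine Finset.sum_congr rfl fun i _ => ?_
  have h1 := congrArg star (he.act_mul (star (y i)) 1)
  have h2 := he.act_mul (x i) 1
  simp only [star_mul, he.star_eq, star_star, OneMemClass.coe_one, mul_one] at h1 h2
  rw [h2, mul_assoc, StarMemClass.coe_star, h1]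
  simp only [mul_assoc]

/-- Insert 1 = ∑ pᵢ e qᵢ before x e, or after e x, and compress: e qᵢ x e = F(qᵢ x) e and e x pᵢ e =
e F(x pᵢ). -/
lemma isQuasiBasis_condExp {n : ℕ} {p q : Fin n → P} (h : ∑ i, (p i : A) * e * q i = 1) :
    he.condExp.IsQuasiBasis p q := by
  intro x
  constructor
  · refine he.eq_of_mul_eq ?_
    calc (x : A) * e = (∑ i, (p i : A) * e * q i) * x * e := by rw [h, one_mul]
      _ = _ := by
        rw [AddSubmonoidClass.coe_finsetSum]
        simp only [Finset.sum_mul, MulMemClass.coe_mul]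
        refine Finset.sum_congr rfl fun i _ => ?_
        rw [mul_assoc (p i : A) (he.condExp _ : P).1, condExp_mul]
        simp [mul_assoc]
  · have hs : ∀ x y : P, e * (x : A) = e * y → x = y := fun x y hxy =>
      star_injective <| he.eq_of_mul_eq <| by
        simpa [he.star_eq] using congrArg star hxy
    refine hs _ _ ?_
    calc e * (x : A) = e * x * (∑ i, (p i : A) * e * q i) := by rw [h, mul_one]
      _ = _ := by
        rw [AddSubmonoidClass.coe_finsetSum]
        simp only [Finset.mul_sum, MulMemClass.coe_mul]
        refine Finset.sum_congr rfl fun i _ => ?_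
        rw [← mul_assoc e (he.condExp _ : P).1, ← he.coe_mem_comm, condExp_mul]
        simp [mul_assoc]

/-! ### The action of `A` on the Hilbert module of `P ⊃ P ∩ {e}'` -/

lemma act_act (a b : A) (x : P) : he.act (a * b) x = he.act a (he.act b x) :=
  he.eq_of_mul_eq <| by 
    rw [he.act_mul, he.act_mul, mul_assoc a (he.act b x : A), he.act_mul]
    simp only [mul_assoc]

lemma act_coe (p x : P) : he.act (p : A) x = p * x :=
  he.eq_of_mul_eq <| by rw [act_mul, MulMemClass.coe_mul]

/-- After multiplication by e both sides become e x* a* y e. -/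
lemma condExp_star_act_mul (a : A) (x y : P) :
    he.condExp (star (he.act a x) * y) = he.condExp (star x * he.act (star a) y) :=
  Subtype.ext <| he.eq_of_mul_eq <| by
    have h1 := congrArg star (he.act_mul a x)
    simp only [star_mul, he.star_eq] at h1
    rw [condExp_mul, condExp_mul, MulMemClass.coe_mul, MulMemClass.coe_mul, StarMemClass.coe_star,
      StarMemClass.coe_star, ← mul_assoc, h1, mul_assoc e (star (x : A) * _) e,
      mul_assoc (star (x : A)) _ e, he.act_mul]
    simp only [mul_assoc]

lemma condExp_star_mul_self (x : P) : ((he.condExp (star x * x) : P) : A)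
    = E.index * (E (star ((x : A) * e) * (x * e)) : A) := by
  rw [coe_condExp, coe_act, star_mul, he.star_eq]
  simp [mul_assoc]

/-- F(x* x) and E((x e)* (x e)) differ by the invertible central factor Index E, so the bound for
left multiplication by a on A e carries over. The constant need not be sharp: it only serves to
extend the operator to the completion. -/
lemma norm_act_le (a : A) (x : P) :
    ‖he.condExp (star (he.act a x) * he.act a x)‖
      ≤ (√(‖E.index‖ * ‖E e‖) * ‖a‖) ^ 2 * ‖he.condExp (star x * x)‖ := by
  have h1 : (E (star ((x : A) * e) * (x * e)) : A) = E e * (he.condExp (star x * x) : P) := by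
    rw [condExp_star_mul_self, ← mul_assoc (E e : A), he.map_mul_index, one_mul]
  have h2 : ‖E (star ((x : A) * e) * (x * e))‖ ≤ ‖E e‖ * ‖he.condExp (star x * x)‖ := by
    change ‖(E (star ((x : A) * e) * (x * e)) : A)‖ ≤ _
    rw [h1]
    exact norm_mul_le _ _
  have h3 := E.norm_map_star_mul_mul_le a (x * e)
  calc ‖he.condExp (star (he.act a x) * he.act a x)‖
      = ‖E.index * (E (star (a * (x * e)) * (a * (x * e))) : A)‖ := by
        rw [← mul_assoc a, ← he.act_mul, ← he.condExp_star_mul_self]; rfl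
    _ ≤ ‖E.index‖ * ‖E (star (a * (x * e)) * (a * (x * e)))‖ := norm_mul_le _ _
    _ ≤ ‖E.index‖ * (‖a‖ ^ 2 * (‖E e‖ * ‖he.condExp (star x * x)‖)) := by
        gcongr; exact h3.trans (by gcongr)
    _ = _ := by rw [mul_pow, Real.sq_sqrt (by positivity)]; ring

/-- The bounded operator `η(x) ↦ η(a · x)` with `(a · x) e = a x e`. -/
def actMap (a : A) : he.condExp.HilbertModule →L[ℂ] he.condExp.HilbertModule :=
  he.condExp.extendMap (he.act a) (√(‖E.index‖ * ‖E e‖) * ‖a‖) (by positivity) (he.norm_act_le a)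

lemma actMap_eta (a : A) (x : P) :
    he.actMap a (he.condExp.eta x) = he.condExp.eta (he.act a x) :=
  he.condExp.extendMap_eta _ _ _ _ x

lemma isModuleMap_actMap (a : A) : he.condExp.IsModuleMap (he.actMap a) :=
  he.condExp.isModuleMap_of_eta fun q x => by
    simp only [rightMul_eta, actMap_eta, act_mul_coe]

lemma isAdjoint_actMap (a : A) : he.condExp.IsAdjoint (he.actMap a) (he.actMap (star a)) :=
  he.condExp.isAdjoint_of_eta fun x y => by
    simp only [actMap_eta, inner_eta, condExp_star_act_mul]

/-- `actMap` as an adjointable operator. -/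
def actOp (a : A) : he.condExp.Adjointable :=
  ⟨he.actMap a, he.isModuleMap_actMap a, he.actMap (star a),
    he.isModuleMap_actMap (star a), he.isAdjoint_actMap a⟩

lemma star_actOp (a : A) : star (he.actOp a) = he.actOp (star a) :=
  he.condExp.star_eq (T := he.actOp a) (S := he.actOp (star a)) (he.isAdjoint_actMap a)

/-- The representation of `A` on the Hilbert module of `P ⊃ P ∩ {e}'`. -/
def rep : A →⋆ₐ[ℂ] he.condExp.Adjointable where
  toFun := he.actOp
  map_one' := Subtype.ext <| he.condExp.ext_eta fun x => by
    change he.actMap 1 _ = he.condExp.eta x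
    rw [actMap_eta]
    congr 1
    exact he.eq_of_mul_eq (by rw [act_mul, one_mul])
  map_mul' a b := Subtype.ext <| he.condExp.ext_eta fun x => by
    change he.actMap (a * b) _ = he.actMap a (he.actMap b (he.condExp.eta x))
    rw [actMap_eta, actMap_eta, actMap_eta, act_act]
  map_zero' := Subtype.ext <| he.condExp.ext_eta fun x => by
    change he.actMap 0 _ = 0
    rw [actMap_eta, ← map_zero he.condExp.eta]
    congr 1
    exact he.eq_of_mul_eq (by rw [act_mul]; simp)
  map_add' a b := Subtype.ext <| he.condExp.ext_eta fun x => by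
    change he.actMap (a + b) _ = he.actMap a (he.condExp.eta x) + he.actMap b (he.condExp.eta x)
    rw [actMap_eta, actMap_eta, actMap_eta, ← map_add]
    congr 1
    exact he.eq_of_mul_eq (by
      rw [act_mul, AddMemClass.coe_add, add_mul, add_mul, add_mul, act_mul, act_mul])
  commutes' c := Subtype.ext <| he.condExp.ext_eta fun x => by
    change he.actMap (algebraMap ℂ A c) _ = algebraMap ℂ
      (he.condExp.HilbertModule →L[ℂ] he.condExp.HilbertModule) c (he.condExp.eta x)
    rw [actMap_eta, Algebra.algebraMap_eq_smul_one, Algebra.algebraMap_eq_smul_one]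
    change _ = c • he.condExp.eta x
    rw [← map_smul]
    congr 1
    exact he.eq_of_mul_eq (by rw [act_mul]; simp)
  map_star' a := (he.star_actOp a).symm

lemma rep_apply_eta (a : A) (x : P) :
    he.condExp.op (he.rep a) (he.condExp.eta x) = he.condExp.eta (he.act a x) :=
  he.actMap_eta a x

lemma rep_coe (p : P) : he.rep (p : A) = he.condExp.lam p :=
  he.condExp.op_injective <| he.condExp.ext_eta fun x => by
    rw [rep_apply_eta, lam_apply_eta, act_coe]

lemma rep_proj : he.rep e = he.condExp.jonesProj :=
  he.condExp.op_injective <| he.condExp.ext_eta fun x => by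
    rw [rep_apply_eta, jonesProj_apply_eta, coe_condExp]

/-! ### Bijectivity onto the basic construction -/

lemma rep_injective {n : ℕ} {p q : Fin n → P} (h : ∑ i, (p i : A) * e * q i = 1) :
    Function.Injective he.rep := by
  refine (injective_iff_map_eq_zero _).mpr fun a ha => ?_
  -- A kernel element annihilates P e, hence also 1 = ∑ pᵢ e qᵢ.
  have h0 : ∀ x : P, a * x * e = 0 := fun x => by
    have h1 := he.rep_apply_eta a x
    rw [ha, map_zero, zero_apply] at h1
    have h2 := (he.isQuasiBasis_condExp h).eta_injective (h1.symm.trans (map_zero _).symm)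
    rw [← he.act_mul, h2]
    simp
  rw [← mul_one a, ← h, Finset.mul_sum]
  refine Finset.sum_eq_zero fun i _ => ?_
  rw [← mul_assoc, ← mul_assoc, h0, zero_mul]

lemma rep_mem {n : ℕ} {p q : Fin n → P} (h : ∑ i, (p i : A) * e * q i = 1) (a : A) :
    he.rep a ∈ he.condExp.basicConstruction := by
  -- A is the span of P e P, so the image already lies in the algebraic span, before closure.
  have h1 : a = ∑ i, (he.act a (p i) : A) * e * q i := by
    simp only [act_mul]
    conv_lhs => rw [← mul_one a, ← h, Finset.mul_sum]
    simp only [mul_assoc]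
  rw [h1, map_sum]
  refine sum_mem fun i _ => ?_
  rw [map_mul, map_mul, rep_coe, rep_coe, rep_proj]
  exact subset_closure (Submodule.subset_span ⟨(_, _), rfl⟩)

/-- The image is all of L_Q, so the basic construction is all of L_Q as well: T = ∑ T λ(pᵢ) e_Q
λ(qᵢ) = ∑ λ(tᵢ) e_Q λ(qᵢ) with η(tᵢ) = T η(pᵢ). -/
lemma rep_surjective {n : ℕ} {p q : Fin n → P} (h : ∑ i, (p i : A) * e * q i = 1) :
    Function.Surjective he.rep := by
  intro T
  have hb := he.isQuasiBasis_condExp h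
  choose t ht using fun i => hb.eta_surjective (he.condExp.op T (he.condExp.eta (p i)))
  refine ⟨∑ i, (t i : A) * e * q i, ?_⟩
  rw [← mul_one T, ← hb.sum_lam_mul_jonesProj_mul_lam, Finset.mul_sum, map_sum]
  refine Finset.sum_congr rfl fun i _ => ?_
  rw [map_mul, map_mul, rep_coe, rep_coe, rep_proj,
    ← he.condExp.mul_lam_mul_jonesProj (ht i).symm]
  simp only [mul_assoc]

lemma isTunnelConstruction (hf : IsFull e) :
    IsTunnelConstruction P (relCommutant P e) e := by
  obtain ⟨n, p, q, h⟩ := he.exists_full hf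
  refine ⟨he.condExp, ⟨n, p, q, he.isQuasiBasis_condExp h⟩, ?_⟩
  refine ⟨StarAlgEquiv.ofBijective
    (NonUnitalStarAlgHom.codRestrict he.rep he.condExp.basicConstruction (he.rep_mem h))
    ⟨fun a b hab => he.rep_injective h (congrArg Subtype.val hab), fun T => ?_⟩,
    he.rep_coe, he.rep_proj⟩
  obtain ⟨a, ha⟩ := he.rep_surjective h T
  exact ⟨a, Subtype.ext ha⟩

end IsTunnelProjection

end CondExp
end CStarInclusion

end

theorem mainTheorem11 {A : Type*} [CStarAlgebra A] (P : StarSubalgebra ℂ A)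
    [IsClosed (P : Set A)] (E : CStarInclusion.CondExp P) (hE : E.HasFiniteIndex)
    (e : A) (he : IsStarProjection e) (hEe : (E e : A) = Ring.inverse E.index) :
    Set.range (fun x : P => e * (x : A) * e)
        = Set.range (fun q : CStarInclusion.relCommutant P e => ((q : P) : A) * e) ∧
      (CStarInclusion.IsFull e →
        CStarInclusion.IsTunnelConstruction P (CStarInclusion.relCommutant P e) e) := by
  -- `Ring.inverse` is a genuine inverse here, as the index is a unit.
  have h : E.IsTunnelProjection e :=
    ⟨hE, he, by rw [hEe, Ring.mul_inverse_cancel _ hE.isUnit_index]⟩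
  exact ⟨h.range_compression, h.isTunnelConstruction⟩
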